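/- A \emph{simple game} $(N,v)$ consists of a finite set $N$ of $n$ players and a function $v\colon 2^N\to\{0,1\}$ with $v(\emptyset)=0$, $v(N)=1$ and $v(S)\le v(T)$ whenever $S\subseteq T\subseteq N$. A coalition $S\subseteq N$ is \emph{winning} if $v(S)=1$ and \emph{losing} if $v(S)=0$. For $p\in\mathbb{R}_{\ge 0}^N$ and $S\subseteq N$ write $p(S)=\sum_{i\in S}p_i$. The \emph{critical threshold value} of $(N,v)$ is $$\alpha(N,v)=\min_{p}\ \max_{W,L}\ \frac{p(L)}{p(W)},$$ where the minimum is over all $p\in\mathbb{R}_{\ge 0}^N$ with $p(W)>0$ for every winning coalition $W$, and the maximum is over all winning coalitions $W$ and all losing coalitions $L$. \textbf{Theorem.} For every simple game $(N,v)$ with $n$ players, the minimum defining $\alpha(N,v)$ is attained, and $$\alpha(N,v)\le \tfrac{2}{7}\,n .$$ -/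

import Mathlib

/-- A simple game on the finite set of players `N`: a monotone `0`-`1` valued function `v` on the
coalitions (subsets of `N`) with `v ∅ = 0` and `v N = 1`. -/
structure SimpleGame (N : Type*) [Fintype N] where
  /-- The value of a coalition. -/
  v : Finset N → ℝ
  zero_or_one : ∀ S, v S = 0 ∨ v S = 1
  mono : ∀ S T, S ⊆ T → v S ≤ v T
  empty : v ∅ = 0
  grand : v Finset.univ = 1

namespace SimpleGame

variable {N : Type*} [Fintype N]

open Classical in
/-- The winning coalitions, those of value `1`. -/
noncomputable def winning (G : SimpleGame N) : Finset (Finset N) :=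
  Finset.univ.filter fun S => G.v S = 1

open Classical in
/-- The losing coalitions, those of value `0`. -/
noncomputable def losing (G : SimpleGame N) : Finset (Finset N) :=
  Finset.univ.filter fun S => G.v S = 0

theorem winning_product_losing_nonempty (G : SimpleGame N) :
    (G.winning ×ˢ G.losing).Nonempty :=
  ⟨(Finset.univ, ∅), by simp [winning, losing, G.empty, G.grand]⟩

/-- The total payoff `p(S)` of the coalition `S`. -/
def payoff (p : N → ℝ) (S : Finset N) : ℝ := ∑ i ∈ S, p i

/-- The payoff vectors `p ≥ 0` for which all the quotients `p(L) / p(W)` are defined, that is,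
for which no winning coalition has payoff `0`. -/
def admissible (G : SimpleGame N) : Set (N → ℝ) :=
  {p | (∀ i, 0 ≤ p i) ∧ ∀ W ∈ G.winning, 0 < payoff p W}

/-- The maximum of `p(L) / p(W)` over all winning coalitions `W` and all losing coalitions `L`. -/
noncomputable def maxRatio (G : SimpleGame N) (p : N → ℝ) : ℝ :=
  (G.winning ×ˢ G.losing).sup' G.winning_product_losing_nonempty
    fun q => payoff p q.2 / payoff p q.1

/-- The critical threshold value `α(N, v)`: the least value of `max p(L) / p(W)` over all payoff
vectors `p ≥ 0`. It is written as an infimum; that it is a minimum is `IsLeast`. -/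
noncomputable def criticalThreshold (G : SimpleGame N) : ℝ :=
  sInf (G.maxRatio '' G.admissible)

end SimpleGame

/-!
The payoff vectors with values in `[0, 1]` that give every winning coalition at least `1` form a
compact convex set `P`, the covering polytope of the game.

*Attainment.* Scaling an admissible `p` by the smallest payoff of a winning coalition and then
truncating at `1` gives a point of `P`, and does not increase the largest quotient
(`exists_mem_coveringPolytope_maxRatio_le`). So it suffices to minimise over the compact set `P`,
on which the largest quotient is continuous.

*The bound.* The complement of a losing coalition `L` meets every winning coalition, since otherwise
monotonicity would make `L` winning; so the indicator of this complement lies in `P`. Hence the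
bilinear function `f p r = ∑ i, p i * (1 - r i)` on `P × P` gives `f p r = p(L)` for a suitable
`r ∈ P`. By the minimax theorem of Sion and von Neumann `f` has a saddle point `(p, r)`, and
`f p r' ≤ f r r = ∑ i, r i * (1 - r i) ≤ n / 4` for all `r' ∈ P`. Thus `p(L) ≤ n / 4` for every
losing `L`, while `p(W) ≥ 1` for every winning `W`, so that even `α ≤ n / 4`.
-/

namespace SimpleGame

theorem continuous_payoff {N : Type*} (S : Finset N) :
    Continuous fun p : N → ℝ => payoff p S := by
  unfold payoff
  fun_prop

variable {N : Type*} [Fintype N]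

theorem mem_winning {G : SimpleGame N} {S : Finset N} : S ∈ G.winning ↔ G.v S = 1 := by
  simp [winning]

theorem mem_losing {G : SimpleGame N} {S : Finset N} : S ∈ G.losing ↔ G.v S = 0 := by
  simp [losing]

theorem univ_mem_winning (G : SimpleGame N) : Finset.univ ∈ G.winning :=
  mem_winning.2 G.grand

/-- A winning coalition is not contained in a losing one. -/
theorem exists_mem_winning_notMem_losing {G : SimpleGame N} {W L : Finset N}
    (hW : W ∈ G.winning) (hL : L ∈ G.losing) : ∃ i ∈ W, i ∉ L := by
  by_contra! h
  have := G.mono W L h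
  rw [mem_winning.1 hW, mem_losing.1 hL] at this
  linarith

theorem payoff_div_le_maxRatio (G : SimpleGame N) (p : N → ℝ) {W L : Finset N}
    (hW : W ∈ G.winning) (hL : L ∈ G.losing) : payoff p L / payoff p W ≤ G.maxRatio p :=
  Finset.le_sup' (fun q : Finset N × Finset N => payoff p q.2 / payoff p q.1)
    (b := (W, L)) (Finset.mem_product.2 ⟨hW, hL⟩)

theorem maxRatio_le {G : SimpleGame N} {p : N → ℝ} {c : ℝ}
    (h : ∀ W ∈ G.winning, ∀ L ∈ G.losing, payoff p L / payoff p W ≤ c) : G.maxRatio p ≤ c :=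
  Finset.sup'_le _ _ fun q hq =>
    h q.1 (Finset.mem_product.1 hq).1 q.2 (Finset.mem_product.1 hq).2

/-- The largest payoff of a losing coalition bounds all quotients once every winning coalition has
payoff at least `1`. -/
theorem maxRatio_le_of_one_le {G : SimpleGame N} {p : N → ℝ} {c : ℝ} (hp : ∀ i, 0 ≤ p i)
    (hW : ∀ W ∈ G.winning, 1 ≤ payoff p W) (hL : ∀ L ∈ G.losing, payoff p L ≤ c) :
    G.maxRatio p ≤ c :=
  maxRatio_le fun W hW' L hL' =>
    (div_le_self (Finset.sum_nonneg fun i _ => hp i) (hW W hW')).trans (hL L hL')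

/-- The covering polytope of a simple game: the payoff vectors with values in `[0, 1]` that give
every winning coalition at least `1`. -/
def coveringPolytope (G : SimpleGame N) : Set (N → ℝ) :=
  Set.Icc 0 1 ∩ {p | ∀ W ∈ G.winning, 1 ≤ payoff p W}

theorem coveringPolytope_subset_admissible (G : SimpleGame N) :
    G.coveringPolytope ⊆ G.admissible :=
  fun _ hp => ⟨hp.1.1, fun W hW => one_pos.trans_le (hp.2 W hW)⟩

theorem isCompact_coveringPolytope (G : SimpleGame N) : IsCompact G.coveringPolytope := by
  refine isCompact_Icc.inter_right ?_
  simp only [Set.ofPred_forall]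
  exact isClosed_biInter fun W _ => isClosed_le continuous_const (continuous_payoff W)

theorem convex_coveringPolytope (G : SimpleGame N) : Convex ℝ G.coveringPolytope := by
  refine (convex_Icc 0 1).inter fun p hp r hr a b ha hb hab W hW => ?_
  have h : payoff (a • p + b • r) W = a * payoff p W + b * payoff r W := by
    simp [payoff, Finset.sum_add_distrib, Finset.mul_sum]
  rw [h]
  nlinarith [mul_le_mul_of_nonneg_left (hp W hW) ha, mul_le_mul_of_nonneg_left (hr W hW) hb]

open Classical in
theorem indicator_compl_mem_coveringPolytope {G : SimpleGame N} {L : Finset N}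
    (hL : L ∈ G.losing) : (fun i => if i ∈ L then (0 : ℝ) else 1) ∈ G.coveringPolytope := by
  have h0 : ∀ i, (0 : ℝ) ≤ if i ∈ L then 0 else 1 := fun i => by split_ifs <;> norm_num
  refine ⟨⟨h0, fun i => ?_⟩, fun W hW => ?_⟩
  · dsimp only
    split_ifs <;> simp
  · obtain ⟨i, hi, hiL⟩ := exists_mem_winning_notMem_losing hW hL
    have := Finset.single_le_sum (fun j _ => h0 j) hi
    rwa [if_neg hiL] at this

theorem coveringPolytope_nonempty (G : SimpleGame N) : G.coveringPolytope.Nonempty :=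
  ⟨_, indicator_compl_mem_coveringPolytope (mem_losing.2 G.empty)⟩

theorem continuousOn_maxRatio (G : SimpleGame N) : ContinuousOn G.maxRatio G.admissible :=
  ContinuousOn.finset_sup'_apply _ fun q hq =>
    (continuous_payoff q.2).continuousOn.div (continuous_payoff q.1).continuousOn
      fun _ hp => (hp.2 q.1 (Finset.mem_product.1 hq).1).ne'

theorem exists_mem_coveringPolytope_maxRatio_le {G : SimpleGame N} {p : N → ℝ}
    (hp : p ∈ G.admissible) : ∃ r ∈ G.coveringPolytope, G.maxRatio r ≤ G.maxRatio p := by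
  obtain ⟨W₀, hW₀, hmin⟩ := G.winning.exists_min_image (payoff p) ⟨_, G.univ_mem_winning⟩
  set m := payoff p W₀
  have hm : 0 < m := hp.2 W₀ hW₀
  have h0 : ∀ i, 0 ≤ min (p i / m) 1 := fun i => le_min (div_nonneg (hp.1 i) hm.le) zero_le_one
  have hone : ∀ W ∈ G.winning, 1 ≤ payoff (fun i => min (p i / m) 1) W := by
    intro W hW
    by_cases h : ∃ i ∈ W, 1 ≤ p i / m
    -- a single truncated player already contributes `1`
    · obtain ⟨i, hi, h1⟩ := h
      have := Finset.single_le_sum (fun j _ => h0 j) hi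
      rwa [min_eq_right h1] at this
    · push Not at h
      have : payoff (fun i => min (p i / m) 1) W = payoff p W / m := by
        rw [payoff, payoff, Finset.sum_div]
        exact Finset.sum_congr rfl fun i hi => min_eq_left (h i hi).le
      rw [this, one_le_div hm]
      exact hmin W hW
  refine ⟨_, ⟨⟨h0, fun i => min_le_right _ _⟩, hone⟩, maxRatio_le_of_one_le h0 hone fun L hL => ?_⟩
  calc payoff (fun i => min (p i / m) 1) L
      ≤ payoff p L / m := by
        rw [payoff, payoff, Finset.sum_div]
        exact Finset.sum_le_sum fun i _ => min_le_left _ _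
    _ ≤ G.maxRatio p := G.payoff_div_le_maxRatio p hW₀ hL

theorem exists_isLeast_maxRatio (G : SimpleGame N) :
    ∃ c, IsLeast (G.maxRatio '' G.admissible) c := by
  obtain ⟨p, hp, hmin⟩ := G.isCompact_coveringPolytope.exists_isMinOn G.coveringPolytope_nonempty
    (G.continuousOn_maxRatio.mono G.coveringPolytope_subset_admissible)
  refine ⟨G.maxRatio p, ⟨p, G.coveringPolytope_subset_admissible hp, rfl⟩, ?_⟩
  rintro _ ⟨q, hq, rfl⟩
  obtain ⟨r, hr, hrq⟩ := exists_mem_coveringPolytope_maxRatio_le hq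
  exact (isMinOn_iff.1 hmin r hr).trans hrq

/-- Evaluating the saddle point of `∑ i, p i * (1 - r i)` on the diagonal bounds its value by
`n / 4`. -/
theorem exists_mem_coveringPolytope_forall_sum_le (G : SimpleGame N) :
    ∃ p ∈ G.coveringPolytope, ∀ r ∈ G.coveringPolytope,
      ∑ i, p i * (1 - r i) ≤ (Fintype.card N : ℝ) / 4 := by
  have hP := G.convex_coveringPolytope
  obtain ⟨p, hp, r, hr, h⟩ := Sion.exists_isSaddlePointOn
    (f := fun p r : N → ℝ => ∑ i, p i * (1 - r i))
    G.coveringPolytope_nonempty hP G.isCompact_coveringPolytope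
    (fun r _ => Continuous.lowerSemicontinuous (by fun_prop) |>.lowerSemicontinuousOn _)
    (fun r _ => ConvexOn.quasiconvexOn ⟨hP, fun x _ y _ a b _ _ _ => le_of_eq <| by
      simp only [Pi.add_apply, Pi.smul_apply, smul_eq_mul, Finset.mul_sum,
        ← Finset.sum_add_distrib]
      exact Finset.sum_congr rfl fun i _ => by ring⟩)
    hP G.coveringPolytope_nonempty G.isCompact_coveringPolytope
    (fun p _ => Continuous.upperSemicontinuous (by fun_prop) |>.upperSemicontinuousOn _)
    (fun p _ => ConcaveOn.quasiconcaveOn ⟨hP, fun x _ y _ a b _ _ hab => le_of_eq <| by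
      simp only [Pi.add_apply, Pi.smul_apply, smul_eq_mul, Finset.mul_sum,
        ← Finset.sum_add_distrib]
      exact Finset.sum_congr rfl fun i _ => by linear_combination p i * hab⟩)
  refine ⟨p, hp, fun r' hr' => (h r hr r' hr').trans ?_⟩
  calc ∑ i, r i * (1 - r i) ≤ ∑ _i : N, (1 / 4 : ℝ) :=
        Finset.sum_le_sum fun i _ => by nlinarith [sq_nonneg (r i - 1 / 2)]
    _ = (Fintype.card N : ℝ) / 4 := by
        rw [Finset.sum_const, Finset.card_univ, nsmul_eq_mul, mul_one_div]

theorem exists_mem_coveringPolytope_maxRatio_le_card_div_four (G : SimpleGame N) :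
    ∃ p ∈ G.coveringPolytope, G.maxRatio p ≤ (Fintype.card N : ℝ) / 4 := by
  classical
  obtain ⟨p, hp, h⟩ := G.exists_mem_coveringPolytope_forall_sum_le
  refine ⟨p, hp, maxRatio_le_of_one_le hp.1.1 hp.2 fun L hL => ?_⟩
  have hL' := h _ (indicator_compl_mem_coveringPolytope hL)
  have : ∑ i, p i * (1 - if i ∈ L then (0 : ℝ) else 1) = payoff p L := by
    simp [payoff, mul_sub, Finset.sum_sub_distrib, Finset.sum_ite,
      ← Finset.sum_filter_add_sum_filter_not Finset.univ (· ∈ L) p]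
  rwa [this] at hL'

end SimpleGame

theorem mainTheorem1 {N : Type*} [Fintype N] (G : SimpleGame N) :
    IsLeast (G.maxRatio '' G.admissible) G.criticalThreshold ∧
      G.criticalThreshold ≤ 2 / 7 * (Fintype.card N : ℝ) := by
  obtain ⟨c, hc⟩ := G.exists_isLeast_maxRatio
  have hα : G.criticalThreshold = c := hc.csInf_eq
  rw [hα]
  refine ⟨hc, ?_⟩
  obtain ⟨p, hp, hle⟩ := G.exists_mem_coveringPolytope_maxRatio_le_card_div_four
  have h := hc.2 ⟨p, G.coveringPolytope_subset_admissible hp, rfl⟩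
  have hn : (0 : ℝ) ≤ Fintype.card N := Nat.cast_nonneg _
  linarith
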